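/- Let $u\in\mathbb{C}$ and $v\in\mathbb{R}\setminus\{0\}$ be such that $u\notin-\mathbb{N}+\frac{2vi}{\pi}\mathbb{Z}$, where $\mathbb{N}=\{0,1,2,\dots\}$; that is, $u\neq -k+\frac{2vi}{\pi}m$ for all $k\in\mathbb{N}$, $m\in\mathbb{Z}$. Consider the Laurent series $$\Psi(u,v,z)=\sum_{n\in\mathbb{Z}}\Gamma\Bigl(u+\frac{2ivn}{\pi}\Bigr)z^n$$ and the open annulus $\mathcal{C}_v=\{z\in\mathbb{C}: e^{-|v|}<|z|<e^{|v|}\}$, whose boundary $\partial\mathcal{C}_v$ is the union of the two circles $|z|=e^{-|v|}$ and $|z|=e^{|v|}$. Then the series converges absolutely at every point of $\mathcal{C}_v$, its sum is holomorphic in $\mathcal{C}_v$, and $\partial\mathcal{C}_v$ is a natural boundary of it: for no point $\zeta\in\partial\mathcal{C}_v$ is there a function holomorphic in a neighbourhood $W$ of $\zeta$ that coincides with $\Psi(u,v,\cdot)$ on $W\cap\mathcal{C}_v$. -/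

import Mathlib

/-- The `n`-th coefficient `Γ(u + 2 i v n / π)` of the Laurent series `Ψ(u, v, z)`. -/
noncomputable def psiCoeff (u : ℂ) (v : ℝ) (n : ℤ) : ℂ :=
  Complex.Gamma (u + 2 * Complex.I * v * n / Real.pi)

/-- The (sum of the) Laurent series `Ψ(u, v, z) = ∑_{n ∈ ℤ} Γ(u + 2 i v n / π) zⁿ`. -/
noncomputable def Psi (u : ℂ) (v : ℝ) (z : ℂ) : ℂ :=
  ∑' n : ℤ, psiCoeff u v n * z ^ n

/-- The open annulus `𝒞_v = {z : e^{-|v|} < |z| < e^{|v|}}`. -/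
def annulusC (v : ℝ) : Set ℂ :=
  {z : ℂ | Real.exp (-|v|) < ‖z‖ ∧ ‖z‖ < Real.exp |v|}

/-- `ζ` is a regular point of `f : U → ℂ`: some function holomorphic in a neighbourhood of `ζ`
coincides with `f` on the part of a neighbourhood of `ζ` that lies in `U`. -/
def IsRegularPoint (f : ℂ → ℂ) (U : Set ℂ) (ζ : ℂ) : Prop :=
  ∃ g : ℂ → ℂ, AnalyticAt ℂ g ζ ∧ ∀ᶠ z in nhdsWithin ζ U, g z = f z

/-- `∂U` is a natural boundary of `f`: the function `f` is holomorphic in `U`, and cannot be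
continued analytically across any point of `∂U`. -/
def HasNaturalBoundary (f : ℂ → ℂ) (U : Set ℂ) : Prop :=
  AnalyticOnNhd ℂ f U ∧ ∀ ζ ∈ frontier U, ¬ IsRegularPoint f U ζ

/-!
For `0 < u.re`, rotating the ray in Euler's integral gives
`∫₀^∞ t ^ (s - 1) exp (-y t) dt = y ^ (-s) Γ(s)` for `0 < y.re`
(`integral_cpow_mul_exp_neg_mul_Ioi_complex`). Taking `y = exp (i θ)` bounds `Γ` on vertical lines
by `exp (-θ |Im s|)` for every `θ < π / 2`, so the Laurent series converges absolutely in the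
annulus; the recurrence `Γ(s + 1) = s Γ(s)` carries this to every `u`.

The same integral exhibits the terms `Γ(u + 2ivn/π) zⁿ`, for `z = exp (-(2iv/π) log y)`, as the
Fourier coefficients of `x ↦ exp (-u L x - y exp (-L x))` up to a factor `y ^ u`, where
`L = π² / v`. By Poisson summation (`tsum_exp_eq_Psi`), `Ψ(u, v, z)` is an elementary nonvanishing
factor times `∑ₖ exp (u L k) exp (-y exp (L k))`, in which `L` may be replaced by `|L|`. The boundary
of the annulus corresponds to the imaginary axis `y.re = 0` without the origin, and there the new
series is lacunary with frequencies growing geometrically and coefficients growing as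
`exp (L u.re k)`. Testing it against a smooth bump modulated by a single frequency isolates the
corresponding term, up to a bounded error, so the series is unbounded near every point of the axis
(`not_bounded_tsum_exp`), while a regular point would make it bounded there.

The general case reduces to `0 < u.re` because `Ψ(u + 1, v, ·)` is obtained from `Ψ(u, v, ·)` by
the differential operator `u + (2iv/π) z d/dz` (`Psi_add_one`), which preserves regular points.
This is where the poles of `Γ` must be avoided.
-/

open Filter Topology MeasureTheory Set
open scoped FourierTransform

/-! ### Euler's integral on the right half-plane and decay of the Gamma function -/

/-- The integrand of Euler's integral in the variable `w = log t` decays exponentially at both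
ends: the double exponential beats `exp (2 σ w)` on the right. -/
theorem exp_sub_mul_exp_le {σ ρ : ℝ} (hσ : 0 < σ) (hρ : 0 < ρ) (w : ℝ) :
    Real.exp (σ * w - ρ * Real.exp w) ≤ Real.exp (2 * σ ^ 2 / ρ) * Real.exp (-(σ * |w|)) := by
  rw [← Real.exp_add, Real.exp_le_exp]
  have h0 : 0 ≤ 2 * σ ^ 2 / ρ := by positivity
  have he := Real.exp_pos w
  rcases le_total 0 w with hw | hw
  · rw [abs_of_nonneg hw]
    have h1 : w ^ 2 / 2 ≤ Real.exp w := by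
      linarith [Real.quadratic_le_exp_of_nonneg hw]
    have h2 : 2 * σ * w - ρ * (w ^ 2 / 2) ≤ 2 * σ ^ 2 / ρ := by
      rw [le_div_iff₀ hρ]
      nlinarith [sq_nonneg (ρ * w - 2 * σ)]
    nlinarith
  · rw [abs_of_nonpos hw]
    nlinarith

theorem summable_exp_neg_mul_abs_int {c : ℝ} (hc : 0 < c) :
    Summable fun k : ℤ => Real.exp (-(c * |(k : ℝ)|)) := by
  have h : Summable fun n : ℕ => Real.exp (n * (-c)) :=
    Real.summable_exp_nat_mul_iff.mpr (by linarith)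
  refine Summable.of_nat_of_neg ?_ ?_ <;>
  · refine h.congr fun n => ?_
    simp [mul_comm]

theorem integrableOn_cpow_mul_exp_neg_mul {a r : ℂ} (ha : 0 < a.re) (hr : 0 < r.re) :
    IntegrableOn (fun t : ℝ => (t : ℂ) ^ (a - 1) * Complex.exp (-(r * t))) (Ioi 0) := by
  have h := integrableOn_rpow_mul_exp_neg_mul_rpow (p := 1) (s := a.re - 1) (b := r.re)
    (by linarith) one_pos hr
  refine Integrable.mono' h ?_ ?_
  · refine ContinuousOn.aestronglyMeasurable ?_ measurableSet_Ioi
    refine ContinuousOn.mul (fun t ht => ContinuousAt.continuousWithinAt ?_) (by fun_prop)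
    exact (Complex.continuousAt_ofReal_cpow_const _ _ (Or.inr (ne_of_gt ht)))
  · refine (ae_restrict_mem measurableSet_Ioi).mono fun t ht => ?_
    rw [norm_mul, Complex.norm_cpow_eq_rpow_re_of_pos ht, Complex.norm_exp]
    simp

/-- Euler's integral along a ray, in the form obtained by scaling: it extends from positive real
`r` to the right half-plane because both sides are holomorphic in `r`. -/
theorem integral_cpow_mul_exp_neg_mul_Ioi_complex {a r : ℂ} (ha : 0 < a.re) (hr : 0 < r.re) :
    ∫ t : ℝ in Ioi 0, (t : ℂ) ^ (a - 1) * Complex.exp (-(r * t)) =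
      r ^ (-a) * Complex.Gamma a := by
  set U : Set ℂ := {z | 0 < z.re}
  have hUo : IsOpen U := isOpen_lt continuous_const Complex.continuous_re
  have hUc : IsPreconnected U := (convex_halfSpace_re_gt 0).isPreconnected
  set F : ℂ → ℂ := fun r => ∫ t : ℝ in Ioi 0, (t : ℂ) ^ (a - 1) * Complex.exp (-(r * t))
  have hF : DifferentiableOn ℂ F U := by
    intro r₀ hr₀
    have hr₀' : 0 < r₀.re := hr₀
    have hb := integrableOn_rpow_mul_exp_neg_mul_rpow (p := 1) (s := a.re) (b := r₀.re / 2)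
      (by linarith) one_pos (by linarith)
    refine DifferentiableAt.differentiableWithinAt ?_
    have := hasDerivAt_integral_of_dominated_loc_of_deriv_le
      (μ := volume.restrict (Ioi (0 : ℝ))) (𝕜 := ℂ)
      (F := fun r t => (t : ℂ) ^ (a - 1) * Complex.exp (-(r * t)))
      (F' := fun r t => (t : ℂ) ^ (a - 1) * (Complex.exp (-(r * t)) * (-(1 * t))))
      (x₀ := r₀) (s := Metric.ball r₀ (r₀.re / 2))
      (Metric.ball_mem_nhds _ (by linarith)) ?_
      (integrableOn_cpow_mul_exp_neg_mul ha hr₀') ?_ ?_ hb ?_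
    · exact this.2.differentiableAt
    · filter_upwards [hUo.mem_nhds hr₀] with z hz
      exact (integrableOn_cpow_mul_exp_neg_mul ha hz).aestronglyMeasurable
    · refine ContinuousOn.aestronglyMeasurable ?_ measurableSet_Ioi
      refine ContinuousOn.mul (fun t ht => ContinuousAt.continuousWithinAt ?_) (by fun_prop)
      exact (Complex.continuousAt_ofReal_cpow_const _ _ (Or.inr (ne_of_gt ht)))
    · refine (ae_restrict_mem measurableSet_Ioi).mono fun t ht z hz => ?_
      have ht' : 0 < t := ht
      have hz' : r₀.re / 2 ≤ z.re := by
        have h1 := (Complex.abs_re_le_norm (z - r₀)).trans_lt (by simpa [dist_eq_norm] using hz)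
        rw [Complex.sub_re] at h1
        linarith [(abs_lt.mp h1).1]
      rw [norm_mul, norm_mul, Complex.norm_cpow_eq_rpow_re_of_pos ht, Complex.norm_exp]
      have e : t ^ a.re = t ^ (a - 1).re * t := by
        rw [← Real.rpow_add_one ht'.ne']; simp
      have e2 : ‖-(1 * (t : ℂ))‖ = t := by simp [abs_of_pos ht']
      rw [e2, e, Real.rpow_one, mul_assoc, mul_comm t]
      gcongr
      simp
      nlinarith
    · refine ae_of_all _ fun t z _ => ?_
      exact (((hasDerivAt_id z).mul_const (t : ℂ)).neg.cexp).const_mul _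
  have hG : DifferentiableOn ℂ (fun r : ℂ => r ^ (-a) * Complex.Gamma a) U := fun z hz =>
    ((differentiableAt_id.cpow_const (Or.inl hz)).mul_const _).differentiableWithinAt
  refine (hF.analyticOnNhd hUo).eqOn_of_preconnected_of_frequently_eq (hG.analyticOnNhd hUo) hUc
    (z₀ := 1) (by simp [U]) ?_ hr
  have hreal : ∀ x : ℝ, 0 < x → F x = (x : ℂ) ^ (-a) * Complex.Gamma a := fun x hx => by
    have := Complex.integral_cpow_mul_exp_neg_mul_Ioi ha hx
    simp only [F]
    rw [this, one_div, Complex.inv_cpow _ _ (by simp [Complex.arg_ofReal_of_nonneg hx.le,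
      Real.pi_pos.ne]), Complex.cpow_neg]
  have ht : Tendsto (fun x : ℝ => (x : ℂ)) (𝓝[>] 1) (𝓝[≠] 1) := by
    refine tendsto_nhdsWithin_of_tendsto_nhds_of_eventually_within _ ?_ ?_
    · exact (Complex.continuous_ofReal.tendsto' 1 1 (by simp)).mono_left nhdsWithin_le_nhds
    · filter_upwards [self_mem_nhdsWithin] with x hx
      have : x ≠ 1 := ne_of_gt hx
      simpa using this
  refine ht.frequently (Eventually.frequently ?_)
  filter_upwards [self_mem_nhdsWithin] with x hx
  exact hreal x (lt_trans one_pos hx)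

/-- Exponential decay of `Γ` on vertical lines, at every rate below `π / 2`. -/
theorem norm_Gamma_le {a : ℂ} (ha : 0 < a.re) {θ : ℝ} (hθ : |θ| < Real.pi / 2) :
    ‖Complex.Gamma a‖ ≤
      (1 / Real.cos θ) ^ a.re * Real.Gamma a.re * Real.exp (-(θ * a.im)) := by
  obtain ⟨h1, h2⟩ := abs_lt.mp hθ
  have hcos : 0 < Real.cos θ := Real.cos_pos_of_mem_Ioo ⟨h1, h2⟩
  set r : ℂ := Complex.exp (θ * Complex.I)
  have hre : r.re = Real.cos θ := Complex.exp_ofReal_mul_I_re θ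
  have key := integral_cpow_mul_exp_neg_mul_Ioi_complex (r := r) ha (by rw [hre]; exact hcos)
  have hlog : Complex.log r = θ * Complex.I := by
    apply Complex.log_exp <;> simp <;> linarith [Real.pi_pos]
  have hrn : ‖r ^ (-a)‖ = Real.exp (θ * a.im) := by
    rw [Complex.cpow_def_of_ne_zero (Complex.exp_ne_zero _), hlog, Complex.norm_exp]
    simp
  have hle : ‖∫ t : ℝ in Ioi 0, (t : ℂ) ^ (a - 1) * Complex.exp (-(r * t))‖ ≤
      ∫ t : ℝ in Ioi 0, t ^ (a.re - 1) * Real.exp (-(Real.cos θ * t)) := by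
    refine (norm_integral_le_integral_norm _).trans (le_of_eq ?_)
    refine setIntegral_congr_fun measurableSet_Ioi fun t ht => ?_
    simp only [norm_mul]
    rw [Complex.norm_cpow_eq_rpow_re_of_pos ht, Complex.norm_exp]
    simp [hre]
  rw [key, Real.integral_rpow_mul_exp_neg_mul_Ioi ha hcos, norm_mul, hrn] at hle
  rw [Real.exp_neg, ← div_eq_mul_inv, le_div_iff₀ (Real.exp_pos _)]
  linarith

/-! ### The Laurent series on the annulus -/

theorem abs_log_norm_lt_of_mem_annulusC {v : ℝ} {z : ℂ} (hz : z ∈ annulusC v) :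
    |Real.log ‖z‖| < |v| := by
  have h0 : 0 < ‖z‖ := (Real.exp_pos _).trans hz.1
  exact abs_lt.mpr ⟨(Real.lt_log_iff_exp_lt h0).mpr hz.1, (Real.log_lt_iff_lt_exp h0).mpr hz.2⟩

theorem ne_zero_of_mem_annulusC {v : ℝ} {z : ℂ} (hz : z ∈ annulusC v) : z ≠ 0 :=
  norm_pos_iff.mp ((Real.exp_pos _).trans hz.1)

theorem isOpen_annulusC (v : ℝ) : IsOpen (annulusC v) :=
  (isOpen_lt continuous_const continuous_norm).inter (isOpen_lt continuous_norm continuous_const)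

theorem psiCoeff_add_one {u : ℂ} {v : ℝ} {n : ℤ}
    (h : u + 2 * Complex.I * v * n / Real.pi ≠ 0) :
    psiCoeff (u + 1) v n = (u + 2 * Complex.I * v * n / Real.pi) * psiCoeff u v n := by
  rw [psiCoeff, psiCoeff, ← Complex.Gamma_add_one _ h]
  ring_nf

theorem summable_norm_psiCoeff_of_re_pos {u : ℂ} (hu : 0 < u.re) {v : ℝ} {z : ℂ}
    (hz : z ∈ annulusC v) : Summable fun n : ℤ => ‖psiCoeff u v n * z ^ n‖ := by
  have hl := abs_log_norm_lt_of_mem_annulusC hz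
  have h0 : 0 < ‖z‖ := norm_pos_iff.mpr (ne_zero_of_mem_annulusC hz)
  have hv : 0 < |v| := (abs_nonneg _).trans_lt hl
  have hpi := Real.pi_pos
  set l := |Real.log ‖z‖| with hldef
  have hl0 : 0 ≤ l := abs_nonneg _
  -- The angle is chosen so that the decay rate `θ * (2 |v| / π)` lies strictly between `l` and
  -- `|v|`.
  obtain ⟨θ, hθ1, hθ2⟩ : ∃ θ : ℝ, l * (Real.pi / 2) / |v| < θ ∧ θ < Real.pi / 2 := by
    apply exists_between
    rw [div_lt_iff₀ hv, mul_comm]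
    gcongr
  have hθ0 : 0 ≤ θ := le_trans (by positivity) hθ1.le
  have hcos : 0 < Real.cos θ := Real.cos_pos_of_mem_Ioo ⟨by linarith, hθ2⟩
  set c := θ * (2 * |v| / Real.pi) - l with hcdef
  have hc : 0 < c := by
    rw [div_lt_iff₀ hv] at hθ1
    rw [hcdef, sub_pos, mul_div_assoc', lt_div_iff₀ hpi]
    linarith
  set A := (1 / Real.cos θ) ^ u.re * Real.Gamma u.re * Real.exp (θ * |u.im|) with hA
  refine Summable.of_nonneg_of_le (fun _ => norm_nonneg _) (fun n => ?_)
    ((summable_exp_neg_mul_abs_int hc).mul_left A)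
  have hG0 : 0 ≤ (1 / Real.cos θ) ^ u.re * Real.Gamma u.re :=
    mul_nonneg (Real.rpow_nonneg (by positivity) _) (Real.Gamma_pos_of_pos hu).le
  set s : ℂ := u + 2 * Complex.I * v * n / Real.pi with hs
  have es : s = u + ((2 * v * n / Real.pi : ℝ) : ℂ) * Complex.I := by
    rw [hs]; push_cast; ring
  have hsre : s.re = u.re := by rw [es]; simp
  have hsim : s.im = u.im + 2 * v * n / Real.pi := by rw [es]; simp
  have hG : ‖Complex.Gamma s‖ ≤
      (1 / Real.cos θ) ^ u.re * Real.Gamma u.re * Real.exp (-(θ * |s.im|)) := by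
    rw [← hsre]
    rcases le_total 0 s.im with h | h
    · rw [abs_of_nonneg h]
      exact norm_Gamma_le (by rwa [hsre]) (by rwa [abs_of_nonneg hθ0])
    · rw [abs_of_nonpos h]
      have := norm_Gamma_le (a := s) (θ := -θ) (by rwa [hsre]) (by rwa [abs_neg, abs_of_nonneg hθ0])
      rw [Real.cos_neg] at this
      simpa using this
  have hzn : ‖z ^ n‖ ≤ Real.exp (l * |(n : ℝ)|) := by
    rw [norm_zpow, ← Real.rpow_intCast, Real.rpow_def_of_pos h0, Real.exp_le_exp, hldef, ← abs_mul]
    exact le_abs_self _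
  have him : 2 * |v| / Real.pi * |(n : ℝ)| - |u.im| ≤ |s.im| := by
    have h1 : 2 * |v| / Real.pi * |(n : ℝ)| = |2 * v * n / Real.pi| := by
      rw [abs_div, abs_mul, abs_mul, abs_of_pos hpi, abs_two]; ring
    rw [h1, hsim]
    have := abs_sub_abs_le_abs_sub (2 * v * n / Real.pi) (-u.im)
    rw [abs_neg] at this
    rwa [show u.im + 2 * v * n / Real.pi = 2 * v * n / Real.pi - -u.im by ring]
  rw [norm_mul]
  calc ‖Complex.Gamma s‖ * ‖z ^ n‖
      ≤ ((1 / Real.cos θ) ^ u.re * Real.Gamma u.re * Real.exp (-(θ * |s.im|))) *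
          Real.exp (l * |(n : ℝ)|) := by gcongr
    _ ≤ ((1 / Real.cos θ) ^ u.re * Real.Gamma u.re *
          Real.exp (-(θ * (2 * |v| / Real.pi * |(n : ℝ)| - |u.im|)))) *
          Real.exp (l * |(n : ℝ)|) := by gcongr
    _ = A * Real.exp (-(c * |(n : ℝ)|)) := by
        rw [hA, hcdef, mul_assoc, mul_assoc (_ * _) (Real.exp _) (Real.exp _), ← Real.exp_add,
          ← Real.exp_add]
        ring_nf

/-- Below the half-plane of convergence of Euler's integral the bound descends from `u + 1` to `u`
by `Γ(s + 1) = s Γ(s)`, since all but finitely many of the arguments `s` have `1 ≤ ‖s‖`. -/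
theorem summable_norm_psiCoeff (u : ℂ) {v : ℝ} {z : ℂ} (hz : z ∈ annulusC v) :
    Summable fun n : ℤ => ‖psiCoeff u v n * z ^ n‖ := by
  obtain ⟨N, hN⟩ := exists_nat_gt (-u.re)
  induction N generalizing u with
  | zero => exact summable_norm_psiCoeff_of_re_pos (by simpa using hN) hz
  | succ N ih =>
    have h1 := ih (u + 1) (by push_cast at hN; simp; linarith)
    have hv : v ≠ 0 := abs_pos.mp ((abs_nonneg _).trans_lt (abs_log_norm_lt_of_mem_annulusC hz))
    have hbig : ∀ᶠ n : ℤ in cofinite, 1 ≤ ‖u + 2 * Complex.I * v * n / Real.pi‖ := by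
      have ht : Tendsto (fun n : ℤ => ‖(n : ℝ)‖) cofinite atTop :=
        tendsto_norm_cocompact_atTop.comp Int.tendsto_coe_cofinite
      have hk : 0 < 2 * |v| / Real.pi := by positivity
      filter_upwards [(ht.const_mul_atTop hk).eventually_ge_atTop (1 + ‖u‖)] with n hn
      have h2 : ‖2 * Complex.I * v * n / Real.pi‖ = 2 * |v| / Real.pi * ‖(n : ℝ)‖ := by
        simp [abs_of_pos Real.pi_pos]; ring
      have h3 := norm_sub_le_norm_add (2 * Complex.I * v * n / Real.pi) u
      rw [add_comm u]
      linarith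
    refine Summable.of_norm_bounded_eventually h1 ?_
    filter_upwards [hbig] with n hn
    have hne : u + 2 * Complex.I * v * n / Real.pi ≠ 0 := norm_pos_iff.mp (one_pos.trans_le hn)
    rw [psiCoeff_add_one hne, norm_norm, mul_assoc, norm_mul (_ + _)]
    exact le_mul_of_one_le_left (norm_nonneg _) hn

/-- Near every point of the annulus the terms of the Laurent series are holomorphic and dominated
by one summable sequence: on a closed sub-annulus `a ≤ ‖w‖ ≤ b`, `‖w‖ ^ n ≤ a ^ n + b ^ n`. -/
theorem exists_nhds_psi_terms_le (u : ℂ) {v : ℝ} {z : ℂ} (hz : z ∈ annulusC v) :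
    ∃ (U : Set ℂ) (c : ℤ → ℝ), IsOpen U ∧ z ∈ U ∧ Summable c ∧
      (∀ n : ℤ, DifferentiableOn ℂ (fun w => psiCoeff u v n * w ^ n) U) ∧
      ∀ (n : ℤ) (w : ℂ), w ∈ U → ‖psiCoeff u v n * w ^ n‖ ≤ c n := by
  obtain ⟨a, ha1, ha2⟩ := exists_between hz.1
  obtain ⟨b, hb1, hb2⟩ := exists_between hz.2
  have ha0 : 0 < a := (Real.exp_pos _).trans ha1
  have hb0 : 0 < b := (norm_nonneg z).trans_lt hb1
  have ham : (a : ℂ) ∈ annulusC v := by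
    simp only [annulusC, mem_ofPred_eq, Complex.norm_real, Real.norm_of_nonneg ha0.le]
    exact ⟨ha1, ha2.trans (hb1.trans hb2)⟩
  have hbm : (b : ℂ) ∈ annulusC v := by
    simp only [annulusC, mem_ofPred_eq, Complex.norm_real, Real.norm_of_nonneg hb0.le]
    exact ⟨ha1.trans (ha2.trans hb1), hb2⟩
  refine ⟨{w | a < ‖w‖ ∧ ‖w‖ < b}, _,
    (isOpen_lt continuous_const continuous_norm).inter (isOpen_lt continuous_norm continuous_const),
    ⟨ha2, hb1⟩, (summable_norm_psiCoeff u ham).add (summable_norm_psiCoeff u hbm), ?_, ?_⟩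
  · intro n w hw
    have hw0 : w ≠ 0 := norm_pos_iff.mp (ha0.trans hw.1)
    exact ((differentiableAt_zpow.mpr (Or.inl hw0)).const_mul _).differentiableWithinAt
  · intro n w hw
    have hw0 : 0 < ‖w‖ := ha0.trans hw.1
    simp only [norm_mul, norm_zpow, Complex.norm_real, Real.norm_of_nonneg ha0.le,
      Real.norm_of_nonneg hb0.le]
    rw [← mul_add]
    gcongr
    have pa : 0 < a ^ n := zpow_pos ha0 n
    have pb : 0 < b ^ n := zpow_pos hb0 n
    rcases le_total 0 n with hn | hn
    · exact (zpow_le_zpow_left₀ hn hw0.le hw.2.le).trans (by linarith)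
    · obtain ⟨m, rfl⟩ : ∃ m, n = -m := ⟨-n, by ring⟩
      have h : a ^ m ≤ ‖w‖ ^ m := zpow_le_zpow_left₀ (by omega) ha0.le hw.1.le
      have h' : ‖w‖ ^ (-m) ≤ a ^ (-m) := by
        rw [zpow_neg, zpow_neg]
        exact inv_anti₀ (zpow_pos ha0 m) h
      linarith

theorem analyticOnNhd_Psi (u : ℂ) (v : ℝ) : AnalyticOnNhd ℂ (Psi u v) (annulusC v) := by
  intro z hz
  obtain ⟨U, c, hU, hzU, hc, hd, hb⟩ := exists_nhds_psi_terms_le u hz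
  exact (Complex.differentiableOn_tsum_of_summable_norm hc hd hU hb).analyticAt (hU.mem_nhds hzU)

/-- Raising `u` by one is the differential operator `u + (2iv/π) z d/dz` on the Laurent series. -/
theorem Psi_add_one {u : ℂ} {v : ℝ} (hu : ∀ n : ℤ, u + 2 * Complex.I * v * n / Real.pi ≠ 0)
    {z : ℂ} (hz : z ∈ annulusC v) :
    Psi (u + 1) v z = u * Psi u v z + 2 * Complex.I * v / Real.pi * z * deriv (Psi u v) z := by
  obtain ⟨U, c, hU, hzU, hc, hd, hb⟩ := exists_nhds_psi_terms_le u hz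
  have hz0 := ne_zero_of_mem_annulusC hz
  have h1 : HasSum (fun n : ℤ => deriv (fun w : ℂ => psiCoeff u v n * w ^ n) z)
      (deriv (Psi u v) z) := Complex.hasSum_deriv_of_summable_norm hc hd hU hb hzU
  have h2 : HasSum (fun n : ℤ => psiCoeff u v n * z ^ n) (Psi u v z) :=
    (summable_norm_psiCoeff u hz).of_norm.hasSum
  rw [← ((h2.mul_left u).add (h1.mul_left (2 * Complex.I * v / Real.pi * z))).tsum_eq, Psi]
  refine tsum_congr fun n => ?_
  have e : z * z ^ (n - 1) = z ^ n := by
    rw [zpow_sub_one₀ hz0]; field_simp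
  rw [psiCoeff_add_one (hu n), deriv_const_mul_field, deriv_zpow, ← e]
  ring

theorem isRegularPoint_Psi_add_one {u : ℂ} {v : ℝ}
    (hu : ∀ n : ℤ, u + 2 * Complex.I * v * n / Real.pi ≠ 0) {ζ : ℂ}
    (h : IsRegularPoint (Psi u v) (annulusC v) ζ) :
    IsRegularPoint (Psi (u + 1) v) (annulusC v) ζ := by
  obtain ⟨g, hg, hgf⟩ := h
  refine ⟨fun z => u * g z + 2 * Complex.I * v / Real.pi * z * deriv g z,
    (analyticAt_const.mul hg).add ((analyticAt_const.mul analyticAt_id).mul hg.deriv), ?_⟩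
  filter_upwards [eventually_eventually_nhdsWithin.mpr hgf, self_mem_nhdsWithin] with z hz hzU
  rw [(isOpen_annulusC v).nhdsWithin_eq hzU] at hz
  have hd : g =ᶠ[𝓝 z] Psi u v := hz
  rw [Psi_add_one hu hzU, hd.deriv_eq, hd.eq_of_nhds]

theorem frontier_annulusC {v : ℝ} (hv : v ≠ 0) :
    frontier (annulusC v) =
      Metric.sphere (0 : ℂ) (Real.exp (-|v|)) ∪ Metric.sphere (0 : ℂ) (Real.exp |v|) := by
  have hv0 : 0 < |v| := abs_pos.mpr hv
  have hlt : Real.exp (-|v|) < Real.exp |v| := Real.exp_lt_exp.mpr (by linarith)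
  have p1 := Real.exp_pos (-|v|)
  have p2 := Real.exp_pos |v|
  rw [frontier, (isOpen_annulusC v).interior_eq]
  -- A point of either circle is a limit of its positive multiples lying in the annulus.
  have key : ∀ (ζ : ℂ) (s : Set ℝ), (1 : ℝ) ∈ closure s →
      (∀ t ∈ s, (t : ℂ) * ζ ∈ annulusC v) → ζ ∈ closure (annulusC v) := by
    intro ζ s h1 hs
    have := map_mem_closure (f := fun t : ℝ => (t : ℂ) * ζ) (by fun_prop) h1 hs
    simpa using this
  ext ζ
  simp only [Set.mem_sdiff, mem_union, mem_sphere_zero_iff_norm]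
  constructor
  · rintro ⟨hc, hn⟩
    have hcl : IsClosed {z : ℂ | Real.exp (-|v|) ≤ ‖z‖ ∧ ‖z‖ ≤ Real.exp |v|} :=
      (isClosed_le continuous_const continuous_norm).inter
        (isClosed_le continuous_norm continuous_const)
    have h : ζ ∈ {z : ℂ | Real.exp (-|v|) ≤ ‖z‖ ∧ ‖z‖ ≤ Real.exp |v|} :=
      closure_minimal (s := annulusC v)
        (fun z (hz : z ∈ annulusC v) => And.intro hz.1.le hz.2.le) hcl hc
    by_contra hne
    rw [not_or] at hne
    exact hn ⟨lt_of_le_of_ne h.1 (Ne.symm hne.1), lt_of_le_of_ne h.2 hne.2⟩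
  · rintro (h | h)
    · refine ⟨key ζ (Ioo 1 (Real.exp |v| / Real.exp (-|v|))) ?_ ?_, fun hm => hm.1.ne' h⟩
      · have : (1 : ℝ) < Real.exp |v| / Real.exp (-|v|) := by rwa [one_lt_div p1]
        rw [closure_Ioo this.ne]
        exact left_mem_Icc.mpr this.le
      · rintro t ⟨ht1, ht2⟩
        rw [lt_div_iff₀ p1] at ht2
        simp only [annulusC, mem_ofPred_eq, norm_mul, Complex.norm_real, h,
          Real.norm_of_nonneg (zero_le_one.trans ht1.le)]
        exact ⟨by nlinarith, ht2⟩
    · refine ⟨key ζ (Ioo (Real.exp (-|v|) / Real.exp |v|) 1) ?_ ?_, fun hm => hm.2.ne h⟩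
      · have : Real.exp (-|v|) / Real.exp |v| < 1 := by rwa [div_lt_one p2]
        rw [closure_Ioo this.ne]
        exact right_mem_Icc.mpr this.le
      · rintro t ⟨ht1, ht2⟩
        have ht0 : 0 ≤ t := le_trans (by positivity) ht1.le
        rw [div_lt_iff₀ p2] at ht1
        simp only [annulusC, mem_ofPred_eq, norm_mul, Complex.norm_real, h,
          Real.norm_of_nonneg ht0]
        exact ⟨ht1, by nlinarith⟩

/-! ### Poisson summation -/

/-- Euler's integral at `u + 2ivn/π` read as a Fourier coefficient: the substitution
`t = exp (-(π² / v) x)` turns `t ^ (2ivn/π)` into `exp (-2πi n x)`. -/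
theorem fourier_exp_mul_exp_neg_exp {u y : ℂ} (hu : 0 < u.re) (hy : 0 < y.re) {v : ℝ}
    (n : ℤ) :
    𝓕 (fun x : ℝ => Complex.exp (-(u * (Real.pi ^ 2 / v : ℝ) * x) -
        y * Real.exp (-(Real.pi ^ 2 / v * x)))) (n : ℝ) =
      |Real.pi ^ 2 / v|⁻¹ * y ^ (-u) * (psiCoeff u v n *
        Complex.exp (-(2 * Complex.I * v / Real.pi * Complex.log y)) ^ n) := by
  have hpi : (Real.pi : ℂ) ≠ 0 := by exact_mod_cast Real.pi_ne_zero
  have hy0 : y ≠ 0 := by rintro rfl; simp at hy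
  set L : ℝ := Real.pi ^ 2 / v
  set G : ℝ → ℂ := fun t => Complex.exp (-(y * t))
  set s : ℂ := ((2 * Real.pi * n : ℝ) : ℂ) * Complex.I
  have hsre : s.re = 0 := by simp [s]
  have hsim : s.im = 2 * Real.pi * n := by simp [s]
  have h := mellin_eq_fourier (fun t => (fun t : ℝ => (t : ℂ) ^ u • G t) (t ^ L)) (s := s)
  rw [mellin_comp_rpow (fun t : ℝ => (t : ℂ) ^ u • G t) s L, mellin_cpow_smul, hsre, hsim] at h
  have e1 : 2 * Real.pi * n / (2 * Real.pi) = (n : ℝ) := by field_simp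
  have e2 : s / L + u = u + 2 * Complex.I * v * n / Real.pi := by
    simp only [s, L]; push_cast; field_simp; ring
  have e3 : mellin G (s / L + u) = y ^ (-(s / L + u)) * psiCoeff u v n := by
    rw [psiCoeff, ← e2, ← integral_cpow_mul_exp_neg_mul_Ioi_complex _ hy]
    · rfl
    · have : s / L = ((2 * Real.pi * n / L : ℝ) : ℂ) * Complex.I := by
        simp only [s]; push_cast; ring
      rw [this]; simpa using hu
  rw [e1, e3] at h
  have e4 : y ^ (-(s / L + u)) = y ^ (-u) *
      Complex.exp (-(2 * Complex.I * v / Real.pi * Complex.log y)) ^ n := by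
    rw [e2, neg_add, Complex.cpow_add _ _ hy0, ← Complex.exp_int_mul,
      Complex.cpow_def_of_ne_zero hy0 (-(_ / _))]
    congr 2
    ring
  rw [e4, Complex.real_smul] at h
  have e5 : (fun x : ℝ => Complex.exp (-(u * L * x) - y * Real.exp (-(L * x)))) =
      fun x : ℝ => Real.exp (-0 * x) • (((Real.exp (-x) ^ L : ℝ) : ℂ) ^ u •
        G (Real.exp (-x) ^ L)) := by
    funext x
    have hne : ((Real.exp (-(L * x)) : ℝ) : ℂ) ≠ 0 := by
      exact_mod_cast (Real.exp_pos _).ne'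
    rw [← Real.exp_mul, show -x * L = -(L * x) by ring, Complex.cpow_def_of_ne_zero hne,
      ← Complex.ofReal_log (Real.exp_pos _).le, Real.log_exp, neg_zero, zero_mul, Real.exp_zero,
      one_smul, smul_eq_mul, ← Complex.exp_add]
    congr 1
    push_cast
    ring
  rw [e5, ← h]
  push_cast
  ring

theorem norm_exp_sub_mul_exp_le {u y : ℂ} (hu : 0 < u.re) (hy : 0 < y.re) (w : ℝ) :
    ‖Complex.exp (u * w - y * Real.exp w)‖ ≤
      Real.exp (2 * u.re ^ 2 / y.re) * Real.exp (-(u.re * |w|)) := by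
  rw [Complex.norm_exp]
  have : (u * w - y * Real.exp w).re = u.re * w - y.re * Real.exp w := by
    rw [Complex.sub_re, Complex.re_mul_ofReal, Complex.re_mul_ofReal]
  rw [this]
  exact exp_sub_mul_exp_le hu hy w

theorem exp_neg_mul_abs_isBigO {c : ℝ} (hc : 0 < c) :
    (fun x : ℝ => Real.exp (-(c * |x|))) =O[cocompact ℝ] fun x : ℝ => |x| ^ (-2 : ℝ) := by
  refine Asymptotics.IsBigO.of_bound (2 / c ^ 2) ?_
  have h0 : ∀ᶠ x : ℝ in cocompact ℝ, x ≠ 0 := by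
    have := (isCompact_singleton (x := (0 : ℝ))).compl_mem_cocompact
    filter_upwards [this] with x hx using hx
  filter_upwards [h0] with x hx
  have hx' : 0 < |x| := abs_pos.mpr hx
  have hp : 0 < c * |x| := mul_pos hc hx'
  have h1 : (c * |x|) ^ 2 / 2 ≤ Real.exp (c * |x|) := by
    linarith [Real.quadratic_le_exp_of_nonneg hp.le]
  rw [Real.norm_of_nonneg (Real.exp_pos _).le, Real.norm_of_nonneg (by positivity),
    Real.rpow_neg hx'.le, Real.rpow_two, Real.exp_neg]
  calc (Real.exp (c * |x|))⁻¹ ≤ ((c * |x|) ^ 2 / 2)⁻¹ := inv_anti₀ (by positivity) h1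
    _ = 2 / c ^ 2 * (|x| ^ 2)⁻¹ := by field_simp

/-- Poisson summation turns the Laurent series with Gamma coefficients, on the half-plane
`0 < y.re` covering the annulus by `y ↦ exp (-(2iv/π) log y)`, into a series of exponentials with
geometrically growing frequencies. -/
theorem tsum_exp_eq_Psi {u y : ℂ} (hu : 0 < u.re) (hy : 0 < y.re) {v : ℝ} (hv : v ≠ 0)
    (hz : Complex.exp (-(2 * Complex.I * v / Real.pi * Complex.log y)) ∈ annulusC v) :
    ∑' k : ℤ, Complex.exp (u * (Real.pi ^ 2 / |v| * k : ℝ) -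
        y * Real.exp (Real.pi ^ 2 / |v| * k)) =
      |Real.pi ^ 2 / v|⁻¹ * y ^ (-u) *
        Psi u v (Complex.exp (-(2 * Complex.I * v / Real.pi * Complex.log y))) := by
  set L : ℝ := Real.pi ^ 2 / v with hL
  have hL0 : L ≠ 0 := div_ne_zero (pow_ne_zero _ Real.pi_ne_zero) hv
  have hLabs : Real.pi ^ 2 / |v| = |L| := by
    rw [hL, abs_div, abs_of_nonneg (by positivity : 0 ≤ Real.pi ^ 2)]
  set f : ℝ → ℂ := fun x => Complex.exp (-(u * L * x) - y * Real.exp (-(L * x))) with hf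
  have hF := fun n : ℤ => fourier_exp_mul_exp_neg_exp hu hy (v := v) n
  have hbig : f =O[cocompact ℝ] fun x : ℝ => |x| ^ (-2 : ℝ) := by
    refine Asymptotics.IsBigO.trans ?_
      (exp_neg_mul_abs_isBigO (c := u.re * |L|) (mul_pos hu (abs_pos.mpr hL0)))
    refine Asymptotics.IsBigO.of_bound (Real.exp (2 * u.re ^ 2 / y.re)) (Eventually.of_forall ?_)
    intro x
    have := norm_exp_sub_mul_exp_le hu hy (-(L * x))
    rw [Real.norm_of_nonneg (Real.exp_pos _).le]
    rw [abs_neg, abs_mul, ← mul_assoc] at this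
    refine le_trans (le_of_eq ?_) this
    simp only [hf]
    push_cast
    congr 3
    ring
  have hP := Real.tsum_eq_tsum_fourier_of_rpow_decay_of_summable (f := f) (by fun_prop)
    one_lt_two hbig ?_ 0
  · have hl : ∑' n : ℤ, f (0 + n) = ∑' k : ℤ, Complex.exp (u * (Real.pi ^ 2 / |v| * k : ℝ) -
        y * Real.exp (Real.pi ^ 2 / |v| * k)) := by
      rw [hLabs]
      rcases le_total 0 L with h | h
      · rw [abs_of_nonneg h, ← (Equiv.neg ℤ).tsum_eq]
        refine tsum_congr fun k => ?_
        simp only [hf, Equiv.neg_apply]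
        push_cast
        congr 1
        ring_nf
      · rw [abs_of_nonpos h]
        refine tsum_congr fun k => ?_
        simp only [hf]
        push_cast
        congr 1
        ring_nf
    rw [← hl, hP, Psi, ← tsum_mul_left]
    refine tsum_congr fun n => ?_
    rw [hF n, QuotientAddGroup.mk_zero, fourier_eval_zero, mul_one, hL]
  · refine Summable.congr ?_ (fun n => (hF n).symm)
    exact ((summable_norm_psiCoeff u hz).of_norm).mul_left _

/-! ### Lacunary series of exponentials -/

/-- Distinct frequencies are separated by a fixed proportion of the larger one, which dominates
both `1` and `exp (L k)` when `0 ≤ K`. -/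
theorem le_abs_exp_sub_exp {L : ℝ} (hL : 0 < L) {k K : ℤ} (hK : 0 ≤ K) (hk : k ≠ K) :
    (1 - Real.exp (-L)) * max 1 (Real.exp (L * k)) ≤
      |Real.exp (L * k) - Real.exp (L * K)| := by
  have h1 : Real.exp (-L) < 1 := by simpa using hL
  have hgap : ∀ {m n : ℤ}, m < n → 0 ≤ n →
      (1 - Real.exp (-L)) * max 1 (Real.exp (L * n)) ≤ Real.exp (L * n) - Real.exp (L * m) := by
    intro m n hmn hn
    have hn' : (0 : ℝ) ≤ n := by exact_mod_cast hn
    have hmn' : (m : ℝ) + 1 ≤ n := by exact_mod_cast hmn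
    have h2 : Real.exp (L * m) ≤ Real.exp (-L) * Real.exp (L * n) := by
      rw [← Real.exp_add, Real.exp_le_exp]; nlinarith
    rw [max_eq_right (Real.one_le_exp (by positivity))]
    linarith
  rcases lt_or_gt_of_ne hk with h | h
  · rw [abs_sub_comm]
    refine le_trans (le_trans ?_ (hgap h hK)) (le_abs_self _)
    have : Real.exp (L * k) ≤ Real.exp (L * K) := by
      rw [Real.exp_le_exp]
      have : (k : ℝ) ≤ K := by exact_mod_cast h.le
      nlinarith
    gcongr
  · exact (hgap h (hK.trans h.le)).trans (le_abs_self _)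

theorem SchwartzMap.exists_norm_le_div_pow (f : SchwartzMap ℝ ℂ) (N : ℕ) :
    ∃ C : ℝ, 0 < C ∧ ∀ x : ℝ, x ≠ 0 → ‖f x‖ ≤ C / |x| ^ N := by
  obtain ⟨C, hC, h⟩ := f.decay N 0
  refine ⟨C, hC, fun x hx => ?_⟩
  rw [le_div_iff₀ (pow_pos (abs_pos.mpr hx) _), mul_comm]
  simpa using h x

/-- A series of exponentials with growing coefficients and geometrically growing frequencies is
unbounded near every point of its line of convergence. Against a smooth bump modulated by one
frequency `exp (L K)` all other terms of the series contribute a bounded amount, because the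
Fourier transform of the bump decays faster than any power, while the term `k = K` contributes a
multiple of `exp (L u.re K)`. -/
theorem not_bounded_tsum_exp {u : ℂ} (hu : 0 < u.re) {L : ℝ} (hL : 0 < L) (t₀ : ℝ) {δ : ℝ}
    (hδ : 0 < δ) (M : ℝ) :
    ¬ ∀ y : ℂ, 0 < y.re → ‖y - t₀ * Complex.I‖ < δ →
      ‖∑' k : ℤ, Complex.exp (u * (L * k : ℝ) - y * Real.exp (L * k))‖ ≤ M := by
  intro hM
  have hM0 : 0 ≤ M := by
    refine (norm_nonneg _).trans (hM (t₀ * Complex.I + (δ / 2 : ℝ)) ?_ ?_)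
    · simpa using hδ
    · rw [add_sub_cancel_left, Complex.norm_real, Real.norm_of_nonneg (by positivity)]
      linarith
  -- A nonnegative smooth bump around `t₀`, supported in the ball of radius `δ / 2`.
  let b : ContDiffBump t₀ := ⟨δ / 4, δ / 2, by positivity, by linarith⟩
  have hbc : Continuous (fun t => (b t : ℂ)) := Complex.continuous_ofReal.comp b.continuous
  have hcs : HasCompactSupport (fun t => (b t : ℂ)) :=
    b.hasCompactSupport.comp_left (g := ((↑) : ℝ → ℂ)) Complex.ofReal_zero
  let φ : SchwartzMap ℝ ℂ := hcs.toSchwartzMap (Complex.ofRealCLM.contDiff.comp b.contDiff)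
  set I₀ : ℝ := ∫ t, b t with hI₀
  have hI₀pos : 0 < I₀ := b.integral_pos
  have hbi : Integrable (fun t => b t) := b.continuous.integrable_of_hasCompactSupport
    b.hasCompactSupport
  obtain ⟨N, hN⟩ := exists_nat_ge (2 * u.re)
  obtain ⟨C, hC, hdec⟩ := SchwartzMap.exists_norm_le_div_pow (𝓕 φ) N
  have hφ : ∀ ξ : ℝ, (𝓕 φ) ξ = ∫ t : ℝ, Complex.exp (-(2 * Real.pi * ξ * t) * Complex.I) * b t := by
    intro ξ
    rw [SchwartzMap.fourier_coe, Real.fourier_eq']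
    refine integral_congr_ae (Eventually.of_forall fun t => ?_)
    have e : (φ t : ℂ) = b t := rfl
    beta_reduce
    rw [smul_eq_mul, e]
    congr 2
    simp
    ring
  set c : ℝ := (1 - Real.exp (-L)) / (2 * Real.pi) with hc
  have hc0 : 0 < c := by
    have : Real.exp (-L) < 1 := by simpa using hL
    have := Real.pi_pos
    apply div_pos <;> linarith
  set D : ℝ := C / c ^ N with hD
  have hD0 : 0 < D := by positivity
  have hsum := (summable_exp_neg_mul_abs_int (c := u.re * L) (by positivity)).mul_left D
  set B : ℝ := ∑' k : ℤ, D * Real.exp (-(u.re * L * |(k : ℝ)|)) with hB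
  -- The growing coefficients are absorbed by the decay of the Fourier transform of the bump.
  have hoff : ∀ k K : ℤ, 0 ≤ K → k ≠ K →
      Real.exp (u.re * (L * k)) *
        ‖(𝓕 φ) ((Real.exp (L * k) - Real.exp (L * K)) / (2 * Real.pi))‖ ≤
      D * Real.exp (-(u.re * L * |(k : ℝ)|)) := by
    intro k K hK hk
    set ξ : ℝ := (Real.exp (L * k) - Real.exp (L * K)) / (2 * Real.pi) with hξ
    have hge : c * max 1 (Real.exp (L * k)) ≤ |ξ| := by
      rw [hξ, abs_div, abs_of_pos (by positivity : 0 < 2 * Real.pi), hc, div_mul_eq_mul_div]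
      exact div_le_div_of_nonneg_right (le_abs_exp_sub_exp hL hK hk) (by positivity)
    have hm : 0 < max 1 (Real.exp (L * k)) := lt_max_of_lt_left one_pos
    have hξ0 : ξ ≠ 0 := abs_pos.mp ((mul_pos hc0 hm).trans_le hge)
    have h1 : ‖(𝓕 φ) ξ‖ ≤ D / max 1 (Real.exp (L * k)) ^ N := by
      refine (hdec ξ hξ0).trans ?_
      rw [hD, div_div, ← mul_pow]
      gcongr
    have h2 : Real.exp (u.re * (L * k)) ≤
        Real.exp (-(u.re * L * |(k : ℝ)|)) * max 1 (Real.exp (L * k)) ^ N := by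
      rcases le_total 0 (k : ℝ) with hk0 | hk0
      · rw [max_eq_right (Real.one_le_exp (by positivity)), ← Real.exp_nat_mul, ← Real.exp_add,
          Real.exp_le_exp, abs_of_nonneg hk0]
        have : 2 * u.re * (L * k) ≤ N * (L * k) := by gcongr
        linarith
      · rw [max_eq_left (Real.exp_le_one_iff.mpr (by nlinarith)), one_pow, mul_one, Real.exp_le_exp,
          abs_of_nonpos hk0]
        linarith
    calc Real.exp (u.re * (L * k)) * ‖(𝓕 φ) ξ‖
        ≤ (Real.exp (-(u.re * L * |(k : ℝ)|)) * max 1 (Real.exp (L * k)) ^ N) *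
            (D / max 1 (Real.exp (L * k)) ^ N) := by gcongr
      _ = D * Real.exp (-(u.re * L * |(k : ℝ)|)) := by field_simp
  -- Isolating the `K`-th frequency.
  have hmain : ∀ K : ℕ, Real.exp (-1) * (Real.exp (u.re * (L * K)) * I₀) ≤ M * I₀ + B := by
    intro K
    set lam : ℤ → ℝ := fun k => Real.exp (L * k) with hlam
    have hlam0 : ∀ k, 0 < lam k := fun k => Real.exp_pos _
    -- Small enough to stay in the ball, and for the damping of the `K`-th term to be harmless.
    set ε : ℝ := min (δ / 2) (1 / lam K) with hε
    have hε0 : 0 < ε := lt_min (by positivity) (by have := hlam0 K; positivity)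
    have hεK : ε * lam K ≤ 1 := by
      rw [← le_div_iff₀ (hlam0 K)]; exact min_le_right _ _
    set F : ℤ → ℝ → ℂ := fun k t =>
      (b t * Complex.exp (lam K * t * Complex.I)) *
        Complex.exp (u * (L * k : ℝ) - (ε + t * Complex.I) * lam k) with hF
    have hFc : ∀ k, Continuous (F k) := fun k => by
      simp only [hF]; fun_prop
    have hFi : ∀ k, Integrable (F k) := fun k =>
      (hFc k).integrable_of_hasCompactSupport (hcs.mul_right.mul_right)
    have hFn : ∀ k t, ‖F k t‖ = Real.exp (u.re * (L * k) - ε * lam k) * b t := by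
      intro k t
      simp only [hF, norm_mul, Complex.norm_exp, Complex.norm_real, Real.norm_of_nonneg b.nonneg]
      simp
      ring
    have hFsum : Summable fun k => ∫ t, ‖F k t‖ := by
      simp_rw [hFn, integral_const_mul]
      refine Summable.mul_right _ ?_
      refine Summable.of_nonneg_of_le (fun k => (Real.exp_pos _).le) (fun k => ?_)
        ((summable_exp_neg_mul_abs_int (c := u.re * L) (by positivity)).mul_left
          (Real.exp (2 * u.re ^ 2 / ε)))
      refine (exp_sub_mul_exp_le hu hε0 (L * k)).trans (le_of_eq ?_)
      rw [abs_mul, abs_of_pos hL, mul_assoc]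
    have hFint : ∀ k, ∫ t, F k t = Complex.exp (u * (L * k : ℝ) - ε * lam k) *
        (𝓕 φ) ((lam k - lam K) / (2 * Real.pi)) := by
      intro k
      rw [hφ, ← integral_const_mul]
      refine integral_congr_ae (Eventually.of_forall fun t => ?_)
      have hpi : (Real.pi : ℂ) ≠ 0 := by exact_mod_cast Real.pi_ne_zero
      simp only [hF]
      rw [mul_assoc, mul_comm (b t : ℂ), ← Complex.exp_add, ← mul_assoc, ← Complex.exp_add]
      congr 2
      push_cast
      field_simp
      ring
    have hswap := integral_tsum_of_summable_integral_norm hFi hFsum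
    have hupper : ‖∑' k, ∫ t, F k t‖ ≤ M * I₀ := by
      rw [hswap, hI₀, ← integral_const_mul]
      refine norm_integral_le_of_norm_le (hbi.const_mul M) (Eventually.of_forall fun t => ?_)
      simp only [hF]
      rw [tsum_mul_left, norm_mul, norm_mul, Complex.norm_real, Real.norm_of_nonneg b.nonneg]
      have e1 : ‖Complex.exp (lam K * t * Complex.I)‖ = 1 := by
        rw [← Complex.ofReal_mul]; exact Complex.norm_exp_ofReal_mul_I _
      rw [e1, mul_one, mul_comm]
      by_cases ht : |t - t₀| < δ / 2
      · refine mul_le_mul_of_nonneg_right (hM _ (by simpa using hε0) ?_) b.nonneg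
        have e2 : (ε : ℂ) + t * Complex.I - t₀ * Complex.I =
            (ε : ℂ) + ((t - t₀ : ℝ) : ℂ) * Complex.I := by push_cast; ring
        rw [e2]
        refine (norm_add_le _ _).trans_lt ?_
        rw [norm_mul, Complex.norm_I, Complex.norm_real, Complex.norm_real, mul_one,
          Real.norm_of_nonneg hε0.le, Real.norm_eq_abs]
        have := min_le_left (δ / 2) (1 / lam K)
        linarith
      · have : b t = 0 := b.zero_of_le_dist (by simpa [Real.dist_eq] using ht)
        simp [this]
    have hFs : Summable fun k => ∫ t, F k t :=
      Summable.of_norm_bounded hFsum fun k => norm_integral_le_integral_norm _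
    have hsplit := hFs.tsum_eq_add_tsum_ite (K : ℤ)
    have hrest : ‖∑' k : ℤ, (if k = (K : ℤ) then 0 else ∫ t, F k t)‖ ≤ B := by
      refine tsum_of_norm_bounded hsum.hasSum fun k => ?_
      split_ifs with h
      · rw [norm_zero]; positivity
      · refine le_trans ?_ (hoff k K (by positivity) h)
        rw [hFint, norm_mul, Complex.norm_exp]
        gcongr
        simp
        have := hlam0 k
        positivity
    have hterm : ‖∫ t, F K t‖ = Real.exp (u.re * (L * K) - ε * lam K) * I₀ := by
      have h0 : (𝓕 φ) ((lam K - lam K) / (2 * Real.pi)) = (I₀ : ℂ) := by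
        rw [hφ, hI₀, ← integral_complex_ofReal]
        refine integral_congr_ae (Eventually.of_forall fun t => ?_)
        simp
      rw [hFint, h0, norm_mul, Complex.norm_exp, Complex.norm_real, Real.norm_of_nonneg hI₀pos.le]
      simp
    have hle : ‖∫ t, F K t‖ ≤ M * I₀ + B := by
      have : ∫ t, F K t = (∑' k, ∫ t, F k t) -
          ∑' k : ℤ, (if k = (K : ℤ) then 0 else ∫ t, F k t) := by
        rw [hsplit]; ring
      rw [this]
      exact (norm_sub_le _ _).trans (add_le_add hupper hrest)
    refine le_trans ?_ hle
    rw [hterm, ← mul_assoc, ← Real.exp_add]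
    gcongr
    linarith
  have ht : Tendsto (fun K : ℕ => Real.exp (-1) * (Real.exp (u.re * (L * K)) * I₀)) atTop atTop := by
    refine Tendsto.const_mul_atTop (Real.exp_pos _) (Tendsto.atTop_mul_const hI₀pos ?_)
    exact Real.tendsto_exp_atTop.comp
      ((tendsto_natCast_atTop_atTop.const_mul_atTop hL).const_mul_atTop hu)
  obtain ⟨K, hK⟩ := (ht.eventually_gt_atTop (M * I₀ + B)).exists
  exact absurd (hmain K) (not_le.mpr hK)

/-! ### The natural boundary -/

theorem exp_log_mem_annulusC {y : ℂ} (hy : 0 < y.re) {v : ℝ} (hv : v ≠ 0) :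
    Complex.exp (-(2 * Complex.I * v / Real.pi * Complex.log y)) ∈ annulusC v := by
  have hpi := Real.pi_pos
  have hv0 : 0 < |v| := abs_pos.mpr hv
  have harg : |y.arg| < Real.pi / 2 := Complex.abs_arg_lt_pi_div_two_iff.mpr (Or.inl hy)
  have e : (-(2 * Complex.I * v / Real.pi * Complex.log y)).re = 2 * v / Real.pi * y.arg := by
    have : -(2 * Complex.I * v / Real.pi * Complex.log y) =
        ((2 * v / Real.pi : ℝ) : ℂ) * -(Complex.I * Complex.log y) := by push_cast; ring
    rw [this, Complex.re_ofReal_mul]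
    simp [Complex.log_im]
  have h : |2 * v / Real.pi * y.arg| < |v| := by
    rw [abs_mul, abs_div, abs_mul, abs_two, abs_of_pos hpi, div_mul_eq_mul_div, div_lt_iff₀ hpi]
    nlinarith
  simp only [annulusC, mem_ofPred_eq, Complex.norm_exp, e, Real.exp_lt_exp]
  exact abs_lt.mp h

/-- Every boundary point of the annulus is the image of a point of the imaginary axis. -/
theorem exists_exp_log_eq {v : ℝ} (hv : v ≠ 0) {ζ : ℂ}
    (hζ : ‖ζ‖ = Real.exp (-|v|) ∨ ‖ζ‖ = Real.exp |v|) :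
    ∃ t₀ : ℝ, t₀ ≠ 0 ∧
      Complex.exp (-(2 * Complex.I * v / Real.pi * Complex.log (t₀ * Complex.I))) = ζ := by
  have hpi : (Real.pi : ℂ) ≠ 0 := by exact_mod_cast Real.pi_ne_zero
  have hvc : (v : ℂ) ≠ 0 := by exact_mod_cast hv
  obtain ⟨η, hη, hη'⟩ : ∃ η : ℝ, (η = 1 ∨ η = -1) ∧ ‖ζ‖ = Real.exp (η * v) := by
    rcases le_total 0 v with h | h
    · rw [abs_of_nonneg h] at hζ
      rcases hζ with h' | h'
      · exact ⟨-1, Or.inr rfl, by rw [h']; ring_nf⟩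
      · exact ⟨1, Or.inl rfl, by rw [h']; ring_nf⟩
    · rw [abs_of_nonpos h] at hζ
      rcases hζ with h' | h'
      · exact ⟨1, Or.inl rfl, by rw [h']; ring_nf⟩
      · exact ⟨-1, Or.inr rfl, by rw [h']; ring_nf⟩
  -- `p` is the logarithm of the point sought: its real part fixes the argument of the image, and
  -- its imaginary part `± π / 2` selects the circle.
  set s : ℝ := -(ζ.arg * Real.pi / (2 * v)) with hs
  set p : ℂ := s + (η * (Real.pi / 2) : ℝ) * Complex.I with hp
  have hlog : Complex.log (Complex.exp p) = p := by
    apply Complex.log_exp <;> rcases hη with rfl | rfl <;> simp [hp] <;> linarith [Real.pi_pos]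
  have hy : Complex.exp p = ((η * Real.exp s : ℝ) : ℂ) * Complex.I := by
    rw [hp, Complex.exp_add]
    rcases hη with rfl | rfl
    · simp
    · simp [Complex.exp_neg]
  refine ⟨η * Real.exp s, mul_ne_zero ?_ (Real.exp_pos _).ne', ?_⟩
  · rcases hη with rfl | rfl <;> norm_num
  · rw [← hy, hlog]
    have e : -(2 * Complex.I * v / Real.pi * p) = (η * v : ℝ) + ζ.arg * Complex.I := by
      have hI := Complex.I_mul_I
      rw [hp, hs]
      push_cast
      field_simp
      linear_combination (-(v : ℂ) * η) * hI
    rw [e, Complex.exp_add, ← Complex.ofReal_exp, ← hη', Complex.norm_mul_exp_arg_mul_I]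

theorem not_isRegularPoint_Psi_of_re_pos {u : ℂ} (hu : 0 < u.re) {v : ℝ} (hv : v ≠ 0) {ζ : ℂ}
    (hζ : ‖ζ‖ = Real.exp (-|v|) ∨ ‖ζ‖ = Real.exp |v|) :
    ¬ IsRegularPoint (Psi u v) (annulusC v) ζ := by
  rintro ⟨g, hg, hgf⟩
  obtain ⟨t₀, ht₀, hE⟩ := exists_exp_log_eq hv hζ
  set E : ℂ → ℂ := fun y => Complex.exp (-(2 * Complex.I * v / Real.pi * Complex.log y))
  set y₀ : ℂ := t₀ * Complex.I
  have hslit : y₀ ∈ Complex.slitPlane := by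
    rw [Complex.mem_slitPlane_iff]
    right
    simpa [y₀] using ht₀
  have hEc : ContinuousAt E y₀ := by
    have := continuousAt_clog hslit
    fun_prop
  have hE' : E y₀ = ζ := hE
  -- `h` equals the lacunary series for `0 < y.re` near `y₀`, and its continuity bounds that series.
  set h : ℂ → ℂ := fun y => |Real.pi ^ 2 / v|⁻¹ * y ^ (-u) * g (E y)
  have hc : ContinuousAt h y₀ := by
    refine (continuousAt_const.mul
      (ContinuousAt.cpow continuousAt_id continuousAt_const hslit)).mul ?_
    refine ContinuousAt.comp (f := E) ?_ hEc
    rw [hE']; exact hg.continuousAt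
  have hbd : ∀ᶠ y in 𝓝 y₀, ‖h y‖ < ‖h y₀‖ + 1 :=
    hc.norm.eventually_lt_const (lt_add_one _)
  have hgE : ∀ᶠ y in 𝓝 y₀, E y ∈ annulusC v → g (E y) = Psi u v (E y) := by
    rw [eventually_nhdsWithin_iff, ← hE'] at hgf
    exact hEc.eventually hgf
  obtain ⟨δ, hδ, hball⟩ := Metric.eventually_nhds_iff.mp (hbd.and hgE)
  have hL : 0 < Real.pi ^ 2 / |v| := div_pos (pow_pos Real.pi_pos _) (abs_pos.mpr hv)
  refine not_bounded_tsum_exp hu hL t₀ hδ (‖h y₀‖ + 1) fun y hy hyδ => ?_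
  have hm := exp_log_mem_annulusC hy hv
  obtain ⟨h1, h2⟩ := hball (by rwa [dist_eq_norm] : dist y y₀ < δ)
  rw [tsum_exp_eq_Psi hu hy hv hm, ← h2 hm]
  exact h1.le

theorem not_isRegularPoint_Psi {u : ℂ} {v : ℝ} (hv : v ≠ 0)
    (hu : ∀ (k : ℕ) (m : ℤ), u ≠ -(k : ℂ) + 2 * v * Complex.I / Real.pi * m) {ζ : ℂ}
    (hζ : ‖ζ‖ = Real.exp (-|v|) ∨ ‖ζ‖ = Real.exp |v|) :
    ¬ IsRegularPoint (Psi u v) (annulusC v) ζ := by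
  obtain ⟨N, hN⟩ := exists_nat_gt (-u.re)
  induction N generalizing u with
  | zero => exact not_isRegularPoint_Psi_of_re_pos (by simpa using hN) hv hζ
  | succ N ih =>
    intro h
    refine ih (u := u + 1) (fun k m hk => hu (k + 1) m ?_) (by push_cast at hN; simp; linarith)
      (isRegularPoint_Psi_add_one (fun n hn => hu 0 (-n) ?_) h)
    · push_cast
      linear_combination hk
    · push_cast
      linear_combination hn

theorem mainTheorem2 (u : ℂ) (v : ℝ) (hv : v ≠ 0)
    (hu : ∀ (k : ℕ) (m : ℤ), u ≠ -(k : ℂ) + 2 * v * Complex.I / Real.pi * m) :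
    (∀ z ∈ annulusC v, Summable fun n : ℤ => psiCoeff u v n * z ^ n) ∧
    frontier (annulusC v) =
      Metric.sphere (0 : ℂ) (Real.exp (-|v|)) ∪ Metric.sphere (0 : ℂ) (Real.exp |v|) ∧
    HasNaturalBoundary (Psi u v) (annulusC v) := by
  refine ⟨fun z hz => (summable_norm_psiCoeff u hz).of_norm, frontier_annulusC hv,
    analyticOnNhd_Psi u v, fun ζ hζ => not_isRegularPoint_Psi hv hu ?_⟩
  rw [frontier_annulusC hv] at hζ
  simpa using hζ
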